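/- **Setting.** A featured graph is a finite undirected graph $G$ with node features $a_G(v)\in\mathbb R^{d}$. A target is a pair $(G,v)$ with $v\in V(G)$ (node target) or $(G,(u,v))$ with $u,v\in V(G)$ (link target). Let $\mathcal X$ be a set of node targets or a set of link targets, for instance all node (or link) targets with $G$ in a given class of featured graphs, or in one fixed graph. Let $L\in\mathbb N$. *Generalized MPNNs.* Let $\mathcal T$ map featured graphs to featured graphs with features in $\mathbb R^{d_0}$, and let $\mathcal V$ assign to each target $x$ with graph $G$ a set $\mathcal V(x)$ of nodes of $\mathcal T(G)$; write $\mathcal T(x):=\mathcal T(G)$. A $(\mathcal T,\mathcal V,\Psi)$-MPNN with $L$ layers computes on $\mathcal T(x)$ the vectors $h^{(0)}(v)=a_{\mathcal T(x)}(v)$ and $$h^{(t)}(v)=\varphi_t\Big(W^{(1)}_t h^{(t-1)}(v)+W^{(2)}_t\sum_{w\in N(v)}h^{(t-1)}(w)\Big)\in\mathbb R^{d_t},\qquad t=1,\dots,L,$$ where $\varphi_t$ is $L_{\varphi_t}$-Lipschitz for the Euclidean norm and $\|W^{(i)}_t\|_2\le B$. It outputs $h(x)=\Psi\big(x,(h^{(L)}(v))_{v\in\mathcal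 V(x)}\big)\in\mathbb R^p$. The pooling $\Psi$ is *sub-sum* if there is $\widetilde C>0$ such that for all $x_1,x_2\in\mathcal X$ $$\|h(x_1)-h(x_2)\|_2\le \widetilde C\sum_{v\in\mathcal V(x_1)}\|h^{(L)}(v)-h^{(L)}(\sigma(v))\|_2$$ for every bijection $\sigma:\mathcal V(x_1)\to\mathcal V(x_2)$ if $|\mathcal V(x_1)|=|\mathcal V(x_2)|$, and, if $|\mathcal V(x_1)|>|\mathcal V(x_2)|$, for every surjection $\sigma:\mathcal V(x_1)\to\mathcal V(x_2)\cup\{*\}$ that identifies distinct nodes only if it sends them to $*$, with $h^{(L)}(*):=0$. (Here $h^{(L)}(v)$ is computed in $\mathcal T(x_1)$ and $h^{(L)}(\sigma(v))$ in $\mathcal T(x_2)$.) *Unrolling distance.* The unrolling tree of depth $0$ at a node $v$ is a single node with the feature of $v$; that of depth $L>0$ has a root with the feature of $v$ and below it the unrolling trees of depth $L-1$ at the neighbours of $v$. For targets $x_1,x_2$ take the depth-$L$ unrolling trees in $\mathcal T(x_i)$ at the nodes of $\mathcal V(x_i)$, and let $q$ be the maximal out-degree in all these trees. Pad each tree by nodes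 with feature $0$ until every node at a level below $L$ has exactly $q$ children, and pad the smaller of the two families by such trees with all features $0$ until both have the same size. This gives two rooted forests $F_1,F_2$, whose edges are directed away from the roots, and $$\mathrm{UD}^{(L)}_{\mathcal T,\mathcal V}(x_1,x_2)=\min_{\varphi}\sum_{z\in V(F_1)}\|a_{F_1}(z)-a_{F_2}(\varphi(z))\|_2,$$ the minimum being over all bijections $\varphi:V(F_1)\to V(F_2)$ that preserve the directed edges. On $\mathcal X\times\{0,1\}$ let $d_\infty((x,y),(x',y'))$ be $\mathrm{UD}^{(L)}_{\mathcal T,\mathcal V}(x,x')$ if $y=y'$, and $\infty$ otherwise. Let $K_\varepsilon$ be the least cardinality of a set $C\subseteq\mathcal X$ such that each $x\in\mathcal X$ has some $c\in C$ with $\mathrm{UD}^{(L)}_{\mathcal T,\mathcal V}(x,c)\le\varepsilon$. *Transductive learning.* Let $m,u\ge1$, let $\mathcal Z=\{(x_i,y_i)\}_{i=1}^{m+u}$ with $x_i\in\mathcal X$, $y_i\in\{0,1\}$, and let $\mathcal H$ be a class of $(\mathcal T,\mathcal V,\Psi)$-MPNNs with $L$ layers as above, with sub-sum $\Psi$ (the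 weights, the $\varphi_t$ and $\Psi$ may vary within $\mathcal H$; the widths $d_0,\dots,d_L,p$ and the constants $L_{\varphi_t}$, $B$ are fixed). A transductive algorithm is a map $\mathcal A:S_{m+u}\to\mathcal H$, $\pi\mapsto\mathcal A_\pi$. It is *$\beta$-uniformly stable* if $\|\mathcal A_\pi(x_k)-\mathcal A_{\pi^{i,j}}(x_k)\|_2\le\beta$ for all $\pi$, all $k$ and all $i\le m<j$, where $\pi^{i,j}$ arises from $\pi$ by exchanging the values at $i$ and $j$. For a loss $\ell:\mathcal H\times\mathcal Z\to[0,\infty)$ put $$R_m=\frac1m\sum_{i=1}^m\ell(\mathcal A_\pi,x_{\pi(i)},y_{\pi(i)}),\qquad R_u=\frac1u\sum_{i=m+1}^{m+u}\ell(\mathcal A_\pi,x_{\pi(i)},y_{\pi(i)}).$$ **Theorem.** There is a constant $C$ that depends only on $L$, $L_\ell$ and $L_{\varphi_1},\dots,L_{\varphi_L}$ such that the following holds in the setting above. Let $\mathcal A$ be $\beta$-uniformly stable with $\beta>0$, and let $\ell$ be bounded by $M$ and such that $\ell(h,\cdot)$ is $L_\ell$-Lipschitz on $\mathcal Z$ with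 respect to $d_\infty$ for every $h\in\mathcal H$. Let $\pi$ be uniformly distributed on $S_{m+u}$. Then for all $\varepsilon>0$ with $K_\varepsilon<\infty$ and all $\delta>0$, with probability at least $1-\delta$, $$|R_m-R_u|\le 2C\varepsilon+M\,K_\varepsilon\Big(\frac1{\sqrt m}+\frac1{\sqrt u}\Big)\sqrt{2(2K_\varepsilon+1)\log2+2\log\tfrac1\delta}+L_\ell\,\beta .$$ (For $\delta>1$ the probability statement is trivial.) -/

import Mathlib

open MeasureTheory
open scoped NNReal ENNReal

noncomputable section

namespace GraphLearning

/-- `ℝⁿ` with the Euclidean norm. -/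
abbrev Vec (n : ℕ) : Type := EuclideanSpace ℝ (Fin n)

/-! ### Featured graphs, node targets and link targets -/

/-- A finite undirected graph with node features in `ℝᵈ`. -/
structure FeatGraph (d : ℕ) where
  V : Type
  [fintypeV : Fintype V]
  graph : SimpleGraph V
  feat : V → Vec d

attribute [instance] FeatGraph.fintypeV

open Classical in
/-- The set of neighbours of a node. -/
def FeatGraph.nbrs {d : ℕ} (G : FeatGraph d) (v : G.V) : Finset G.V :=
  Finset.univ.filter fun w => G.graph.Adj v w

/-- A prediction target: a graph with one of its nodes, or a graph with a pair of its nodes. -/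
inductive Target (d : ℕ) where
  | node (G : FeatGraph d) (v : G.V) : Target d
  | link (G : FeatGraph d) (u v : G.V) : Target d

/-- The graph to which a target belongs. -/
def Target.graph {d : ℕ} : Target d → FeatGraph d
  | .node G _ => G
  | .link G _ _ => G

/-- All node targets `(G, v)`. -/
def nodeTargets (d : ℕ) : Set (Target d) := {x | ∃ G v, x = Target.node G v}

/-- All link targets `(G, (u, v))`. -/
def linkTargets (d : ℕ) : Set (Target d) := {x | ∃ G u v, x = Target.link G u v}

/-! ### Unrolling trees and their padding -/

/-- Finite rooted trees with node features in `ℝᵈ`: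
a root feature, a number of children, and the subtree under each child. -/
inductive RTree (d : ℕ) : Type where
  | mk (a : Vec d) (n : ℕ) (child : Fin n → RTree d) : RTree d

/-- The maximal number of children of a node of the tree. -/
def RTree.maxOutDeg {d : ℕ} : RTree d → ℕ
  | .mk _ n child => max n (Finset.univ.sup fun i => (child i).maxOutDeg)

/-- The unrolling tree `unr G L v` of depth `L` at the node `v`. The children of the root are
listed in an arbitrary order. -/
def unr {d : ℕ} (G : FeatGraph d) : ℕ → G.V → RTree d
  | 0, v => .mk (G.feat v) 0 Fin.elim0
  | L + 1, v => .mk (G.feat v) (G.nbrs v).card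
      fun i => unr G L ((G.nbrs v).equivFin.symm i).1

/-- Feature of the node at position `p` in the padded tree in which every non-leaf node has
exactly `q` children (`q` at least the maximal out-degree): a position is the list of the child
indices on the way down from the root, and nodes added by the padding have feature `0`. -/
def RTree.padFeat {d q : ℕ} : RTree d → List (Fin q) → Vec d
  | .mk a _ _, [] => a
  | .mk _ n child, i :: p => if h : i.1 < n then (child ⟨i.1, h⟩).padFeat p else 0

/-- The nodes of the complete `q`-ary rooted tree of depth `L`, as positions. -/
def Pos (q L : ℕ) : Type := {p : List (Fin q) // p.length ≤ L}

instance (q L : ℕ) : Fintype (Pos q L) :=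
  (List.finite_length_le (Fin q) L).fintype

/-- The nodes of a forest of `k` complete `q`-ary trees of depth `L`. -/
abbrev ForestNode (k q L : ℕ) : Type := Fin k × Pos q L

/-- Directed edges of the forest: `b` is a child of `a` in the same tree. -/
def ForestEdge (k q L : ℕ) (a b : ForestNode k q L) : Prop :=
  a.1 = b.1 ∧ ∃ i : Fin q, b.2.1 = a.2.1 ++ [i]

/-- `min_φ ∑_x ‖f x - g (φ x)‖`, over all edge-preserving bijections `φ` of the forest. -/
def forestDist {d k q L : ℕ} (f g : ForestNode k q L → Vec d) : ℝ :=
  ⨅ φ : ForestEdge k q L ≃r ForestEdge k q L, ∑ x, ‖f x - g (φ x)‖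

section Unrolling

variable {d e : ℕ} (T : FeatGraph d → FeatGraph e)
  (sel : (x : Target d) → Finset (T x.graph).V) (L : ℕ)

/-- The family of the unrolling trees in `T(G)` of the nodes selected for the target `x`. -/
def unrollings (x : Target d) (i : Fin (sel x).card) : RTree e :=
  unr (T x.graph) L ((sel x).equivFin.symm i).1

/-- The maximal out-degree of the unrolling trees of the target `x`. -/
def unrollDeg (x : Target d) : ℕ :=
  Finset.univ.sup fun i => (unrollings T sel L x i).maxOutDeg

/-- The features of the padded forest of the target `x`, with `k` trees in which each non-leaf node
has `q` children: padded unrolling trees, followed by trees all of whose features are `0`. -/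
def paddedForest (k q : ℕ) (x : Target d) : ForestNode k q L → Vec e :=
  fun a => if h : a.1.1 < (sel x).card then
    (unrollings T sel L x ⟨a.1.1, h⟩).padFeat a.2.1 else 0

/-- The unrolling distance of depth `L` for the transformation `T` and the selection `sel`. -/
def UD (x y : Target d) : ℝ :=
  let k := max (sel x).card (sel y).card
  let q := max (unrollDeg T sel L x) (unrollDeg T sel L y)
  forestDist (paddedForest T sel L k q x) (paddedForest T sel L k q y)

/-- The metric on the labels `{0, 1}` with distance `∞` between distinct labels. -/
def labelDist (y y' : Bool) : ℝ≥0∞ := if y = y' then 0 else ⊤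

/-- The distance `d_∞` on labelled targets. -/
def dInfty (z z' : Target d × Bool) : ℝ≥0∞ :=
  max (ENNReal.ofReal (UD T sel L z.1 z'.1)) (labelDist z.2 z'.2)

end Unrolling

/-- The covering number of `X`: the least cardinality of a set `C ⊆ X` such that every point of `X`
is at distance at most `ε` from some point of `C` (and `⊤` if no finite `C` exists). -/
def coveringNumber {α : Type*} (X : Set α) (dist : α → α → ℝ) (ε : ℝ) : ℕ∞ :=
  ⨅ (C : Set α) (_ : C ⊆ X) (_ : ∀ x ∈ X, ∃ c ∈ C, dist x c ≤ ε), C.encard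

/-! ### Generalized MPNNs -/

/-- Parameters of a message-passing layer from `ℝᵃ` to `ℝᵇ` with sum aggregation. -/
structure Layer (a b : ℕ) where
  mid : ℕ
  W₁ : Vec a →L[ℝ] Vec mid
  W₂ : Vec a →L[ℝ] Vec mid
  φ : Vec mid → Vec b

/-- `v ↦ φ (W₁ h(v) + W₂ ∑_{u ∈ N(v)} h(u))`. -/
def Layer.apply {a b e : ℕ} (ly : Layer a b) (G : FeatGraph e) (h : G.V → Vec a) :
    G.V → Vec b :=
  fun v => ly.φ (ly.W₁ (h v) + ly.W₂ (∑ u ∈ G.nbrs v, h u))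

section MPNN

variable {d L : ℕ} {dim : Fin (L + 1) → ℕ} {T : FeatGraph d → FeatGraph (dim 0)}
  {sel : (x : Target d) → Finset (T x.graph).V} {p : ℕ}

/-- Node representations `h⁽ᵗ⁾` for `t = 0, …, L`, with `h⁽⁰⁾` the node features. -/
def hidden (layer : (t : Fin L) → Layer (dim t.castSucc) (dim t.succ)) (G : FeatGraph (dim 0)) :
    (t : Fin (L + 1)) → G.V → Vec (dim t) :=
  Fin.induction (motive := fun t => G.V → Vec (dim t)) G.feat
    fun t h => (layer t).apply G h

variable (dim T sel p) in
/-- A generalized MPNN with `L` layers of widths `dim 0, …, dim L` for the transformation `T` and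
the selection `sel`. The pooling function is given, for each target, the vectors of the selected
nodes, indexed by these nodes. -/
structure GenMPNN where
  layer : (t : Fin L) → Layer (dim t.castSucc) (dim t.succ)
  pool : (x : Target d) → (sel x → Vec (dim (Fin.last L))) → Vec p

/-- The final representation of the node `v` of `T(G)`, where `G` is the graph of the target. -/
def GenMPNN.nodeRep (h : GenMPNN dim T sel p) (x : Target d) (v : sel x) :
    Vec (dim (Fin.last L)) :=
  hidden h.layer (T x.graph) (Fin.last L) v.1

/-- The output of the generalized MPNN on a target. -/
def GenMPNN.out (h : GenMPNN dim T sel p) (x : Target d) : Vec p :=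
  h.pool x (h.nodeRep x)

/-- The sub-sum property of the pooling function on the targets in `X`. The extra point `*` of
an extended bijection is `none`, and its representation is `0`. -/
def GenMPNN.SubSum (h : GenMPNN dim T sel p) (X : Set (Target d)) : Prop :=
  ∃ C : ℝ, 0 < C ∧ ∀ x₁ ∈ X, ∀ x₂ ∈ X,
    ((sel x₂).card < (sel x₁).card →
      ∀ σ : sel x₁ → Option (sel x₂), Function.Surjective σ →
        (∀ v w, v ≠ w → σ v = σ w → σ v = none) →
        ‖h.out x₁ - h.out x₂‖ ≤
          C * ∑ v, ‖h.nodeRep x₁ v - (σ v).elim 0 (h.nodeRep x₂)‖) ∧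
    ((sel x₁).card = (sel x₂).card →
      ∀ σ : sel x₁ ≃ sel x₂,
        ‖h.out x₁ - h.out x₂‖ ≤ C * ∑ v, ‖h.nodeRep x₁ v - h.nodeRep x₂ (σ v)‖)

/-- Layer `t` has an `Lφ t`-Lipschitz function `φ` and weights of operator norm at most `B`. -/
def GenMPNN.Bounded (h : GenMPNN dim T sel p) (Lφ : Fin L → ℝ≥0) (B : ℝ) : Prop :=
  ∀ t, LipschitzWith (Lφ t) (h.layer t).φ ∧ ‖(h.layer t).W₁‖ ≤ B ∧ ‖(h.layer t).W₂‖ ≤ B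

/-! ### Transductive learning -/

/-- Uniform transductive stability on the inputs `x`: exchanging the training position `i` with the
test position `j` changes the output on each input by at most `β`. -/
def TransductiveStable {m u : ℕ} (A : Equiv.Perm (Fin (m + u)) → GenMPNN dim T sel p)
    (x : Fin (m + u) → Target d) (β : ℝ) : Prop :=
  ∀ (π : Equiv.Perm (Fin (m + u))) (i : Fin m) (j : Fin u) (k : Fin (m + u)),
    ‖(A π).out (x k) - (A (π * Equiv.swap (Fin.castAdd u i) (Fin.natAdd m j))).out (x k)‖ ≤ β

end MPNN

/-- The training risk `R_m` of a loss with value `loss i` at the `i`-th data point, for the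
ordering `π` of the data. -/
def riskTrain {m u : ℕ} (loss : Fin (m + u) → ℝ) (π : Equiv.Perm (Fin (m + u))) : ℝ :=
  (1 / m : ℝ) * ∑ i : Fin m, loss (π (Fin.castAdd u i))

/-- The test risk `R_u`. -/
def riskTest {m u : ℕ} (loss : Fin (m + u) → ℝ) (π : Equiv.Perm (Fin (m + u))) : ℝ :=
  (1 / u : ℝ) * ∑ j : Fin u, loss (π (Fin.natAdd m j))

end GraphLearning

end

namespace GraphLearning

/-! The proof discretises the labelled targets. Take a cover of `X` by `K` balls of radius `ε` in
the unrolling distance and put two data points in one cell if they have the same chosen centre and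
the same label. This gives at most `2K` cells, and inside a cell each loss varies by at most `2 * ε
* Lℓ`. Replacing a loss by a cellwise constant function therefore changes each of the two risks by
at most that amount. The remaining difference is a combination of cell frequency differences with
coefficients in `[0, M]`. Such a combination is largest at a vertex of the box, so it is at most `M`
times the largest frequency difference over unions of cells (`abs_meanDiff_le_of_cells`). There are
at most `2 ^ (2K)` unions, and they do not depend on the hypothesis. A Hoeffding bound for random
permutations with a union bound (`card_perm_exists_cells_le`) thus controls all losses at once,
including the one that the algorithm selects from `π`.

The geometric input is the triangle inequality for `UD`. It is not immediate, since each pair of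
targets is padded to its own size. The value does not depend on the padding (`UD_eq_forestDist`),
because an optimal matching in one padded forest can be carried to another at no extra cost. Its
part between positions present in both forests is a partial injection that respects parents, hence
extends to an automorphism (`exists_portraitMap_extend`, `exists_relIso_portraitMap`). The pairs
that are lost have a zero feature on at least one side, so they saved nothing over leaving both
features unmatched (`sum_norm_sub_le_of_agree`). -/

/-! ### Comparing matching costs on two finite sets -/

/-- Two matchings that agree wherever both are defined: the cost of the second one is at most the
cost of the first one, if all features vanish outside the intersection of their domains. -/
theorem sum_norm_sub_le_of_agree {α E : Type*} [DecidableEq α] [NormedAddCommGroup E]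
    {V V' : Finset α} {θ θ' : α → α} (hθ : Set.BijOn θ V V) (hθ' : Set.BijOn θ' V' V')
    {F G : α → E} (hF : ∀ w, F w ≠ 0 → w ∈ V ∧ w ∈ V') (hG : ∀ w, G w ≠ 0 → w ∈ V ∧ w ∈ V')
    (h : ∀ w ∈ V, w ∈ V' → θ w ∈ V' → θ' w = θ w) :
    ∑ w ∈ V', ‖F w - G (θ' w)‖ ≤ ∑ w ∈ V, ‖F w - G (θ w)‖ := by
  have key : ∀ H : α → E, (∀ w, H w ≠ 0 → w ∈ V ∧ w ∈ V') →
      ∑ w ∈ V, ‖H w‖ = ∑ w ∈ V', ‖H w‖ := by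
    intro H hH
    have h1 : ∑ w ∈ V ∩ V', ‖H w‖ = ∑ w ∈ V, ‖H w‖ :=
      Finset.sum_subset Finset.inter_subset_left fun w _ hw => by
        by_contra h0
        exact hw (Finset.mem_inter.2 (hH w fun h => h0 (by rw [h, norm_zero])))
    have h2 : ∑ w ∈ V ∩ V', ‖H w‖ = ∑ w ∈ V', ‖H w‖ :=
      Finset.sum_subset Finset.inter_subset_right fun w _ hw => by
        by_contra h0
        exact hw (Finset.mem_inter.2 (hH w fun h => h0 (by rw [h, norm_zero])))
    rw [← h1, h2]
  have perm : ∀ (U : Finset α) (τ : α → α), Set.BijOn τ U U →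
      ∑ w ∈ U, ‖G (τ w)‖ = ∑ w ∈ U, ‖G w‖ := fun U τ hτ =>
    Finset.sum_nbij τ (fun _ ha => hτ.mapsTo ha) hτ.injOn hτ.surjOn fun _ _ => rfl
  -- The total mass of `F` and `G` is the same on both domains, so it suffices to compare the
  -- savings `‖F‖ + ‖G‖ - ‖F - G‖` of matched pairs. A saving is never negative and vanishes when
  -- one of the two features is zero. Hence only pairs that lie in both domains count, and there the
  -- matchings agree.
  have overlap : ∑ w ∈ V, (‖F w‖ + ‖G (θ w)‖ - ‖F w - G (θ w)‖) ≤
      ∑ w ∈ V', (‖F w‖ + ‖G (θ' w)‖ - ‖F w - G (θ' w)‖) := by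
    have hR : ∑ w ∈ V with w ∈ V' ∧ θ w ∈ V', (‖F w‖ + ‖G (θ w)‖ - ‖F w - G (θ w)‖) =
        ∑ w ∈ V, (‖F w‖ + ‖G (θ w)‖ - ‖F w - G (θ w)‖) := by
      refine Finset.sum_subset (Finset.filter_subset _ _) fun w hw hw' => ?_
      by_cases h1 : F w = 0
      · simp [h1]
      · by_cases h2 : G (θ w) = 0
        · simp [h2]
        · exact absurd (Finset.mem_filter.2 ⟨hw, (hF w h1).2, (hG _ h2).2⟩) hw'
    rw [← hR]
    calc _ = ∑ w ∈ V with w ∈ V' ∧ θ w ∈ V', (‖F w‖ + ‖G (θ' w)‖ - ‖F w - G (θ' w)‖) := by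
          refine Finset.sum_congr rfl fun w hw => ?_
          obtain ⟨h1, h2, h3⟩ := Finset.mem_filter.1 hw
          rw [h w h1 h2 h3]
      _ ≤ _ := by
          refine Finset.sum_le_sum_of_subset_of_nonneg (fun w hw => ?_) fun w _ _ => ?_
          · exact (Finset.mem_filter.1 hw).2.1
          · exact sub_nonneg.2 (norm_sub_le _ _)
  simp only [Finset.sum_sub_distrib, Finset.sum_add_distrib, perm V θ hθ, perm V' θ' hθ',
    key F hF, key G hG] at overlap
  linarith

/-! ### Addresses of forest nodes and extension of partial automorphisms -/

/-- The map on lists of naturals that acts on the head `j` of `j :: p` by `s p`. -/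
def portraitMap (s : List ℕ → ℕ → ℕ) : List ℕ → List ℕ
  | [] => []
  | j :: p => s p j :: portraitMap s p

theorem portraitMap_eq_nil {s : List ℕ → ℕ → ℕ} {w : List ℕ} : portraitMap s w = [] ↔ w = [] := by
  cases w <;> simp [portraitMap]

/-- A partial injection that respects parents extends to a map that acts on the children of each
node by a permutation. -/
theorem exists_portraitMap_extend (b : List ℕ → ℕ) {R : Set (List ℕ)} {θ : List ℕ → List ℕ}
    (hnil : θ [] = []) (htail : ∀ j p, j :: p ∈ R → p ∈ R)
    (hθ : ∀ j p, j :: p ∈ R → j < b p ∧ ∃ i < b p, θ (j :: p) = i :: θ p)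
    (hinj : Set.InjOn θ R) :
    ∃ s : List ℕ → ℕ → ℕ, (∀ p, Set.MapsTo (s p) (Set.Iio (b p)) (Set.Iio (b p))) ∧
      (∀ p, Set.InjOn (s p) (Set.Iio (b p))) ∧ ∀ w ∈ R, portraitMap s w = θ w := by
  classical
  have hs : ∀ p, ∃ f : ℕ → ℕ, Set.MapsTo f (Set.Iio (b p)) (Set.Iio (b p)) ∧
      Set.InjOn f (Set.Iio (b p)) ∧ ∀ j, j :: p ∈ R → θ (j :: p) = f j :: θ p := by
    intro p
    have hhead : ∀ j, j :: p ∈ R → θ (j :: p) = (θ (j :: p)).headD 0 :: θ p ∧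
        (θ (j :: p)).headD 0 < b p := by
      intro j hj
      obtain ⟨-, i, hi, h⟩ := hθ j p hj
      rw [h]
      exact ⟨rfl, hi⟩
    -- Among the children of `p` that lie in `R`, the head of the image determines the image, since
    -- the tail is `θ p`. So `θ` induces a partial injection of child indices, which extends to a
    -- bijection. The default of `headD` never matters, because these images are nonempty.
    obtain ⟨g, hg⟩ := Finset.exists_equiv_extend_of_card_eq (α := Fin (b p))
      (t := Finset.range (b p)) (by simp)
      (s := Finset.univ.filter fun j : Fin (b p) => j.1 :: p ∈ R)
      (f := fun j => (θ (j.1 :: p)).headD 0)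
      (by
        intro i hi
        obtain ⟨j, hj, rfl⟩ := Finset.mem_image.1 hi
        exact Finset.mem_range.2 (hhead j (Finset.mem_filter.1 hj).2).2)
      (by
        intro i hi j hj hij
        have hi' := (Finset.mem_filter.1 (Finset.mem_coe.1 hi)).2
        have hj' := (Finset.mem_filter.1 (Finset.mem_coe.1 hj)).2
        have : θ (i.1 :: p) = θ (j.1 :: p) := by
          rw [(hhead i hi').1, (hhead j hj').1]
          exact congrArg (· :: θ p) hij
        exact Fin.ext (List.cons.inj (hinj hi' hj' this)).1)
    refine ⟨fun j => if h : j < b p then (g ⟨j, h⟩ : ℕ) else j, ?_, ?_, ?_⟩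
    · intro j hj
      have hj' : j < b p := hj
      simp only [hj', dif_pos, Set.mem_Iio]
      exact Finset.mem_range.1 (g ⟨j, hj'⟩).2
    · intro i hi j hj hij
      have hi' : i < b p := hi
      have hj' : j < b p := hj
      simp only [hi', hj', dif_pos] at hij
      exact congrArg Fin.val (g.injective (Subtype.ext hij))
    · intro j hj
      have hjb := (hθ j p hj).1
      have := hg ⟨j, hjb⟩ (Finset.mem_filter.2 ⟨Finset.mem_univ _, hj⟩)
      simp only [hjb, dif_pos, this]
      exact (hhead j hj).1
  choose s hs1 hs2 hs3 using hs
  refine ⟨s, hs1, hs2, fun w => ?_⟩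
  induction w with
  | nil => intro _; simp [portraitMap, hnil]
  | cons j p ih =>
    intro h
    rw [portraitMap, ih (htail j p h), hs3 p j h]

/-- The number of children of the node with address `p` in a forest of `k` trees whose non-leaf
nodes have `q` children; the address `[]` is that of a virtual parent of all roots. -/
def branching (k q : ℕ) (p : List ℕ) : ℕ := if p = [] then k else q

/-- The address (deepest index first) of a node of a forest of `k` complete `q`-ary trees of
depth `L`, or of the virtual parent of the roots. -/
def IsAddr (k q L : ℕ) : List ℕ → Prop
  | [] => True
  | j :: p => j < branching k q p ∧ p.length ≤ L ∧ IsAddr k q L p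

/-- The child indices on the way down to a node, deepest index first. -/
def addr {k q L : ℕ} (a : ForestNode k q L) : List ℕ :=
  (a.2.1.map Fin.val).reverse ++ [a.1.1]

theorem addr_ne_nil {k q L : ℕ} (a : ForestNode k q L) : addr a ≠ [] := by simp [addr]

theorem addr_injective (k q L : ℕ) : Function.Injective (addr : ForestNode k q L → List ℕ) := by
  rintro ⟨i, p, hp⟩ ⟨j, r, hr⟩ h
  simp only [addr] at h
  obtain ⟨h1, h2⟩ := List.append_inj' h rfl
  have h3 := List.map_injective_iff.2 Fin.val_injective (List.reverse_injective h1)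
  have h4 : i = j := Fin.ext (by simpa using h2)
  subst h3 h4
  rfl

/-- The last entry selects the tree and does not count towards the depth, so addresses have up to `L
+ 1` entries. -/
theorem isAddr_append_singleton {k q L : ℕ} (p : List ℕ) (i : ℕ) :
    IsAddr k q L (p ++ [i]) ↔ i < k ∧ (∀ j ∈ p, j < q) ∧ p.length ≤ L := by
  induction p with
  | nil => simp [IsAddr, branching]
  | cons j p ih =>
    rw [List.cons_append, IsAddr, ih]
    simp [branching]
    constructor
    · rintro ⟨h1, h2, h3, h4, h5⟩
      exact ⟨h3, ⟨h1, h4⟩, h2⟩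
    · rintro ⟨h3, ⟨h1, h4⟩, h2⟩
      exact ⟨h1, h2, h3, h4, by omega⟩

/-- Addresses place the nodes of forests of all sizes in one type, where differently padded forests
can be intersected. With the deepest index first, passing to the parent means taking the tail. -/
theorem exists_addr_eq_iff {k q L : ℕ} (w : List ℕ) :
    (∃ a : ForestNode k q L, addr a = w) ↔ w ≠ [] ∧ IsAddr k q L w := by
  constructor
  · rintro ⟨⟨i, p, hp⟩, rfl⟩
    refine ⟨addr_ne_nil _, (isAddr_append_singleton _ _).2 ⟨i.2, ?_, by simpa using hp⟩⟩
    simp only [List.mem_reverse, List.mem_map]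
    rintro _ ⟨j, -, rfl⟩
    exact j.2
  · rintro ⟨hne, hw⟩
    obtain ⟨p, i, rfl⟩ : ∃ p i, w = p ++ [i] :=
      ⟨w.dropLast, w.getLast hne, (List.dropLast_append_getLast hne).symm⟩
    obtain ⟨hi, hp, hl⟩ := (isAddr_append_singleton _ _).1 hw
    refine ⟨⟨⟨i, hi⟩, (p.reverse.pmap (fun j hj => ⟨j, hj⟩) (fun j hj => hp j (by simpa using hj))),
      by simpa using hl⟩, ?_⟩
    simp [addr, List.map_pmap]

theorem forestEdge_iff {k q L : ℕ} (a b : ForestNode k q L) :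
    ForestEdge k q L a b ↔ ∃ j, addr b = j :: addr a := by
  constructor
  · rintro ⟨h1, i, h2⟩
    exact ⟨i.1, by simp [addr, h1, h2]⟩
  · rintro ⟨j, h⟩
    obtain ⟨b1, bp, hb⟩ := b
    obtain ⟨a1, ap, ha⟩ := a
    simp only [addr, ← List.cons_append] at h
    obtain ⟨h1, h2⟩ := List.append_inj' h rfl
    refine ⟨Fin.ext (by simpa using h2.symm), ?_⟩
    have h3 : bp.map Fin.val = ap.map Fin.val ++ [j] := by
      rw [← List.reverse_reverse (bp.map Fin.val), h1]; simp
    obtain ⟨l1, l2, rfl, h4, h5⟩ := List.map_eq_append_iff.1 h3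
    obtain ⟨i, l3, rfl, -, h7⟩ := List.map_eq_cons_iff.1 h5
    obtain rfl := List.map_eq_nil_iff.1 h7
    exact ⟨i, congrArg (· ++ [i]) (List.map_injective_iff.2 Fin.val_injective h4)⟩

/-- A portrait of permutations induces an automorphism of the forest. -/
theorem exists_relIso_portraitMap {k q L : ℕ} {s : List ℕ → ℕ → ℕ}
    (hmaps : ∀ p, Set.MapsTo (s p) (Set.Iio (branching k q p)) (Set.Iio (branching k q p)))
    (hinj : ∀ p, Set.InjOn (s p) (Set.Iio (branching k q p))) :
    ∃ φ : ForestEdge k q L ≃r ForestEdge k q L, ∀ a, addr (φ a) = portraitMap s (addr a) := by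
  have hlen : ∀ w, (portraitMap s w).length = w.length := by
    intro w
    induction w with
    | nil => rfl
    | cons j p ih => simp [portraitMap, ih]
  -- The branching number distinguishes only the virtual parent from all other nodes, and the
  -- portrait fixes `[]`.
  have hb : ∀ p, branching k q (portraitMap s p) = branching k q p := by
    intro p; simp [branching, portraitMap_eq_nil]
  have hmap : ∀ w, IsAddr k q L w → IsAddr k q L (portraitMap s w) := by
    intro w
    induction w with
    | nil => exact id
    | cons j p ih =>
      rintro ⟨h1, h2, h3⟩
      exact ⟨by rw [hb]; exact hmaps p h1, by rw [hlen]; exact h2, ih h3⟩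
  have hinj' : ∀ w w', IsAddr k q L w → IsAddr k q L w' →
      portraitMap s w = portraitMap s w' → w = w' := by
    intro w
    induction w with
    | nil => intro w' _ _ h; exact (portraitMap_eq_nil.1 h.symm).symm
    | cons j p ih =>
      rintro (_ | ⟨j', p'⟩) h1 h2 h
      · exact portraitMap_eq_nil.1 h
      · obtain ⟨h3, h4⟩ := List.cons.inj h
        obtain rfl := ih p' h1.2.2 h2.2.2 h4
        rw [hinj p h1.1 h2.1 h3]
  have hex : ∀ a : ForestNode k q L, ∃ b : ForestNode k q L, addr b = portraitMap s (addr a) :=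
    fun a => (exists_addr_eq_iff _).2 ⟨fun h => addr_ne_nil a (portraitMap_eq_nil.1 h),
      hmap _ ((exists_addr_eq_iff _).1 ⟨a, rfl⟩).2⟩
  have hA : ∀ a : ForestNode k q L, IsAddr k q L (addr a) :=
    fun a => ((exists_addr_eq_iff _).1 ⟨a, rfl⟩).2
  choose f hf using hex
  have hfinj : Function.Injective f := fun a b hab =>
    addr_injective k q L (hinj' _ _ (hA a) (hA b) (by rw [← hf, ← hf, hab]))
  refine ⟨⟨Equiv.ofBijective f (Finite.injective_iff_bijective.1 hfinj), ?_⟩, hf⟩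
  intro a b
  rw [forestEdge_iff, forestEdge_iff]
  simp only [Equiv.ofBijective_apply, hf]
  constructor
  · rintro ⟨j, h⟩
    obtain ⟨j', p, hp⟩ := List.exists_cons_of_ne_nil (addr_ne_nil b)
    have hp' := hA b
    rw [hp] at h hp'
    exact ⟨j', by rw [hp, hinj' p _ hp'.2.2 (hA a) (List.cons.inj h).2]⟩
  · rintro ⟨j, h⟩
    exact ⟨s (addr a) j, by rw [h]; rfl⟩

/-- An automorphism of the forest respects parents, where the parent of a root is virtual. -/
theorem exists_addr_relIso_cons {k q L : ℕ} (φ : ForestEdge k q L ≃r ForestEdge k q L)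
    {a : ForestNode k q L} {j : ℕ} {p : List ℕ} (h : addr a = j :: p) :
    (p = [] ∧ ∃ i, addr (φ a) = [i]) ∨ ∃ c, addr c = p ∧ ∃ i, addr (φ a) = i :: addr (φ c) := by
  have hA : ∀ a : ForestNode k q L, IsAddr k q L (addr a) :=
    fun a => ((exists_addr_eq_iff _).1 ⟨a, rfl⟩).2
  by_cases hp : p = []
  · refine Or.inl ⟨hp, ?_⟩
    obtain ⟨i, r, hr⟩ := List.exists_cons_of_ne_nil (addr_ne_nil (φ a))
    by_cases hr0 : r = []
    · exact ⟨i, by rw [hr, hr0]⟩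
    -- If the image of a root had a real parent `c`, then `φ.symm c` would be a parent of that root.
    · have hr' := hA (φ a)
      rw [hr] at hr'
      obtain ⟨c, rfl⟩ := (exists_addr_eq_iff (k := k) (q := q) (L := L) r).2 ⟨hr0, hr'.2.2⟩
      have he : ForestEdge k q L (φ (φ.symm c)) (φ a) := by
        rw [φ.apply_symm_apply]; exact (forestEdge_iff _ _).2 ⟨i, hr⟩
      obtain ⟨i', hi'⟩ := (forestEdge_iff _ _).1 (φ.map_rel_iff.1 he)
      rw [h, hp] at hi'
      exact absurd (List.cons.inj hi').2.symm (addr_ne_nil _)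
  · right
    have ha := hA a
    rw [h] at ha
    obtain ⟨c, rfl⟩ := (exists_addr_eq_iff (k := k) (q := q) (L := L) p).2 ⟨hp, ha.2.2⟩
    exact ⟨c, rfl, (forestEdge_iff _ _).1 (φ.map_rel_iff.2 ((forestEdge_iff _ _).2 ⟨j, h⟩))⟩

/-! ### Concentration for uniformly distributed permutations -/

/-- Composing `σ` with the transposition of `a j` and `b j` changes the sign of the `j`-th
difference and fixes the others. Averaging over this symmetry replaces one exponential factor by a
`cosh`, which is at most `exp (μ ^ 2 / 2)`. The pairs are removed one at a time in this way, with no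
independence needed. -/
theorem sum_perm_exp_sum_le {α : Type*} [Fintype α] [DecidableEq α] {ι : Type*} [DecidableEq ι]
    {f : α → ℝ} (hf : ∀ i j, |f i - f j| ≤ 1) {a b : ι → α} (ha : Function.Injective a)
    (hb : Function.Injective b) (hab : ∀ i j, a i ≠ b j) (μ : ℝ) (s : Finset ι) :
    ∑ σ : Equiv.Perm α, Real.exp (μ * ∑ i ∈ s, (f (σ (a i)) - f (σ (b i)))) ≤
      (Fintype.card α).factorial * Real.exp (s.card * (μ ^ 2 / 2)) := by
  induction s using Finset.induction_on with
  | empty => simp [Fintype.card_perm]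
  | insert j s hj ih =>
    set d : ι → Equiv.Perm α → ℝ := fun i σ => f (σ (a i)) - f (σ (b i)) with hd
    set R : Equiv.Perm α → ℝ := fun σ => Real.exp (μ * ∑ i ∈ s, d i σ) with hR
    have hsplit : ∀ σ, Real.exp (μ * ∑ i ∈ insert j s, d i σ) = Real.exp (μ * d j σ) * R σ := by
      intro σ
      rw [Finset.sum_insert hj, mul_add, Real.exp_add]
    have hdj : ∀ σ, d j (σ * Equiv.swap (a j) (b j)) = -d j σ := by
      intro σ; simp [hd]
    have hRj : ∀ σ, R (σ * Equiv.swap (a j) (b j)) = R σ := by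
      intro σ
      simp only [hR, hd]
      congr 2
      refine Finset.sum_congr rfl fun i hi => ?_
      have hij : i ≠ j := fun h => hj (h ▸ hi)
      rw [Equiv.Perm.mul_apply, Equiv.Perm.mul_apply,
        Equiv.swap_apply_of_ne_of_ne (ha.ne hij) (hab i j),
        Equiv.swap_apply_of_ne_of_ne (hab j i).symm (hb.ne hij)]
    have hswap : ∑ σ, Real.exp (μ * d j σ) * R σ = ∑ σ, Real.exp (-(μ * d j σ)) * R σ := by
      rw [← Equiv.sum_comp (Equiv.mulRight (Equiv.swap (a j) (b j)))]
      refine Finset.sum_congr rfl fun σ _ => ?_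
      rw [Equiv.coe_mulRight, hRj, hdj, mul_neg]
    have hcosh : ∑ σ, Real.exp (μ * d j σ) * R σ = ∑ σ, Real.cosh (μ * d j σ) * R σ := by
      have : ∑ σ, Real.cosh (μ * d j σ) * R σ = (∑ σ, Real.exp (μ * d j σ) * R σ +
          ∑ σ, Real.exp (-(μ * d j σ)) * R σ) / 2 := by
        rw [← Finset.sum_add_distrib, Finset.sum_div]
        refine Finset.sum_congr rfl fun σ _ => ?_
        rw [Real.cosh_eq]; ring
      rw [this, ← hswap]; ring
    calc ∑ σ, Real.exp (μ * ∑ i ∈ insert j s, d i σ)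
        = ∑ σ, Real.cosh (μ * d j σ) * R σ := by simp only [hsplit, hcosh]
      _ ≤ ∑ σ, Real.exp (μ ^ 2 / 2) * R σ := by
          refine Finset.sum_le_sum fun σ _ => mul_le_mul_of_nonneg_right ?_ (Real.exp_pos _).le
          refine (Real.cosh_le_exp_half_sq _).trans (Real.exp_le_exp.2 ?_)
          have h1 : d j σ ^ 2 ≤ 1 := (sq_le_one_iff_abs_le_one _).2 (hf _ _)
          rw [mul_pow]
          have := mul_le_mul_of_nonneg_left h1 (sq_nonneg μ)
          linarith
      _ ≤ Real.exp (μ ^ 2 / 2) *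
            ((Fintype.card α).factorial * Real.exp (s.card * (μ ^ 2 / 2))) := by
          rw [← Finset.mul_sum]
          exact mul_le_mul_of_nonneg_left ih (Real.exp_pos _).le
      _ = _ := by
          rw [Finset.card_insert_of_notMem hj, Nat.cast_add, Nat.cast_one, add_mul, one_mul,
            Real.exp_add]
          ring

/-- The mean of `f ∘ σ` over the positions `a` minus its mean over the positions `b`. -/
noncomputable def meanDiff {α : Type*} {m u : ℕ} (a : Fin m → α) (b : Fin u → α) (f : α → ℝ)
    (σ : Equiv.Perm α) : ℝ :=
  (1 / m : ℝ) * ∑ i, f (σ (a i)) - (1 / u : ℝ) * ∑ j, f (σ (b j))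

/-- For samples of different sizes, the difference of means is an average over the `u` cyclic shifts
`c` of paired differences, where `a i` is paired with `b (i + c)`. Each index of `b` occurs equally
often. Convexity of `exp` then reduces to the paired bound for each single shift. -/
theorem sum_perm_exp_meanDiff_le {α : Type*} [Fintype α] [DecidableEq α]
    {f : α → ℝ} (hf : ∀ i j, |f i - f j| ≤ 1) {m u : ℕ} (hm : 0 < m) (hmu : m ≤ u)
    {a : Fin m → α} {b : Fin u → α} (ha : Function.Injective a)
    (hb : Function.Injective b) (hab : ∀ i j, a i ≠ b j) (t : ℝ) :
    ∑ σ : Equiv.Perm α, Real.exp (m * t * meanDiff a b f σ) ≤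
      (Fintype.card α).factorial * Real.exp (m * (t ^ 2 / 2)) := by
  have hu : 0 < u := hm.trans_le hmu
  have : NeZero u := ⟨hu.ne'⟩
  have hm' : (m : ℝ) ≠ 0 := Nat.cast_ne_zero.2 hm.ne'
  have hu' : (u : ℝ) ≠ 0 := Nat.cast_ne_zero.2 hu.ne'
  set ι : Fin u → Fin m → Fin u := fun c i => Fin.castLE hmu i + c with hι
  have hmean : ∀ σ : Equiv.Perm α, m * t * meanDiff a b f σ =
      ∑ c : Fin u, (1 / u : ℝ) * (t * ∑ i, (f (σ (a i)) - f (σ (b (ι c i))))) := by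
    intro σ
    have h1 : ∑ c : Fin u, ∑ i, f (σ (b (ι c i))) = m * ∑ j, f (σ (b j)) := by
      rw [Finset.sum_comm]
      have : ∀ i : Fin m, ∑ c, f (σ (b (ι c i))) = ∑ j, f (σ (b j)) := fun i =>
        Equiv.sum_comp (Equiv.addLeft (Fin.castLE hmu i)) fun j => f (σ (b j))
      simp [this]
    rw [← Finset.mul_sum, ← Finset.mul_sum]
    simp only [Finset.sum_sub_distrib, h1, meanDiff]
    simp
    field_simp
  calc ∑ σ : Equiv.Perm α, Real.exp (m * t * meanDiff a b f σ)
      ≤ ∑ σ : Equiv.Perm α, ∑ c : Fin u, (1 / u : ℝ) *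
          Real.exp (t * ∑ i, (f (σ (a i)) - f (σ (b (ι c i))))) := by
        refine Finset.sum_le_sum fun σ _ => ?_
        rw [hmean]
        have := convexOn_exp.map_sum_le (t := (Finset.univ : Finset (Fin u)))
          (w := fun _ => (1 / u : ℝ))
          (p := fun c => t * ∑ i, (f (σ (a i)) - f (σ (b (ι c i)))))
          (fun _ _ => by positivity) (by simp [hu']) (fun _ _ => Set.mem_univ _)
        simpa only [smul_eq_mul] using this
    _ = ∑ c : Fin u, (1 / u : ℝ) * ∑ σ : Equiv.Perm α,
          Real.exp (t * ∑ i, (f (σ (a i)) - f (σ (b (ι c i))))) := by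
        rw [Finset.sum_comm]
        simp only [Finset.mul_sum]
    _ ≤ ∑ _c : Fin u, (1 / u : ℝ) *
          ((Fintype.card α).factorial * Real.exp (m * (t ^ 2 / 2))) := by
        refine Finset.sum_le_sum fun c _ => mul_le_mul_of_nonneg_left ?_ (by positivity)
        have hbι : Function.Injective fun i => b (ι c i) := fun i j h =>
          Fin.castLE_injective hmu (add_right_cancel (hb h))
        simpa using sum_perm_exp_sum_le hf ha hbι (fun i j => hab i _) t Finset.univ
    _ = _ := by
        simp
        field_simp

/-- Chernoff's argument with the exponent `m * t`, which minimises the bound. -/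
theorem card_perm_le_meanDiff_of_le {α : Type*} [Fintype α] [DecidableEq α]
    {f : α → ℝ} (hf : ∀ i j, |f i - f j| ≤ 1) {m u : ℕ} (hm : 0 < m) (hmu : m ≤ u)
    {a : Fin m → α} {b : Fin u → α} (ha : Function.Injective a)
    (hb : Function.Injective b) (hab : ∀ i j, a i ≠ b j) {t : ℝ} (ht : 0 ≤ t) :
    ((Finset.univ.filter fun σ : Equiv.Perm α => t ≤ meanDiff a b f σ).card : ℝ) ≤
      (Fintype.card α).factorial * Real.exp (-(m * t ^ 2 / 2)) := by
  have h := sum_perm_exp_meanDiff_le hf hm hmu ha hb hab t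
  have h2 : ((Finset.univ.filter fun σ : Equiv.Perm α => t ≤ meanDiff a b f σ).card : ℝ) *
      Real.exp (m * t * t) ≤ ∑ σ : Equiv.Perm α, Real.exp (m * t * meanDiff a b f σ) := by
    rw [← nsmul_eq_mul]
    refine (Finset.card_nsmul_le_sum _ (fun σ => Real.exp (m * t * meanDiff a b f σ)) _ ?_).trans
      (Finset.sum_le_sum_of_subset_of_nonneg (Finset.filter_subset _ _)
        fun _ _ _ => (Real.exp_pos _).le)
    intro σ hσ
    exact Real.exp_le_exp.2 (mul_le_mul_of_nonneg_left (Finset.mem_filter.1 hσ).2 (by positivity))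
  rw [← le_div_iff₀ (Real.exp_pos _)] at h2
  refine h2.trans ((div_le_div_of_nonneg_right h (Real.exp_pos _).le).trans_eq ?_)
  rw [mul_div_assoc, ← Real.exp_sub]
  congr 2
  ring

theorem meanDiff_swap {α : Type*} {m u : ℕ} (a : Fin m → α) (b : Fin u → α) (f : α → ℝ)
    (σ : Equiv.Perm α) : meanDiff b a f σ = -meanDiff a b f σ := by
  simp [meanDiff]

theorem meanDiff_neg {α : Type*} {m u : ℕ} (a : Fin m → α) (b : Fin u → α) (f : α → ℝ)
    (σ : Equiv.Perm α) : meanDiff a b (fun i => -f i) σ = -meanDiff a b f σ := by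
  simp [meanDiff]; ring

/-- Hoeffding's inequality for the difference of two sample means under a random permutation. -/
theorem card_perm_le_abs_meanDiff {α : Type*} [Fintype α] [DecidableEq α]
    {f : α → ℝ} (hf : ∀ i j, |f i - f j| ≤ 1) {m u : ℕ} (hm : 0 < m) (hu : 0 < u)
    {a : Fin m → α} {b : Fin u → α} (ha : Function.Injective a)
    (hb : Function.Injective b) (hab : ∀ i j, a i ≠ b j) {t : ℝ} (ht : 0 ≤ t) :
    ((Finset.univ.filter fun σ : Equiv.Perm α => t ≤ |meanDiff a b f σ|).card : ℝ) ≤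
      2 * ((Fintype.card α).factorial * Real.exp (-((min m u : ℕ) * t ^ 2 / 2))) := by
  have hneg : ∀ i j, |(-f i) - (-f j)| ≤ 1 := fun i j => by
    rw [neg_sub_neg, abs_sub_comm]; exact hf i j
  have hsplit : (Finset.univ.filter fun σ : Equiv.Perm α => t ≤ |meanDiff a b f σ|) ⊆
      (Finset.univ.filter fun σ : Equiv.Perm α => t ≤ meanDiff a b f σ) ∪
      (Finset.univ.filter fun σ : Equiv.Perm α => t ≤ -meanDiff a b f σ) := by
    intro σ
    simp [le_abs]
  have hcard := (Finset.card_le_card hsplit).trans (Finset.card_union_le _ _)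
  have hcard' : ((Finset.univ.filter fun σ : Equiv.Perm α => t ≤ |meanDiff a b f σ|).card : ℝ) ≤
      (Finset.univ.filter fun σ : Equiv.Perm α => t ≤ meanDiff a b f σ).card +
      (Finset.univ.filter fun σ : Equiv.Perm α => t ≤ -meanDiff a b f σ).card := by
    exact_mod_cast hcard
  rcases le_total m u with h | h
  · have h1 := card_perm_le_meanDiff_of_le hf hm h ha hb hab ht
    have h2 := card_perm_le_meanDiff_of_le hneg hm h ha hb hab ht
    simp only [meanDiff_neg] at h2
    rw [min_eq_left h]
    linarith
  · have h1 := card_perm_le_meanDiff_of_le hneg hu h hb ha (fun i j => (hab j i).symm) ht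
    have h2 := card_perm_le_meanDiff_of_le hf hu h hb ha (fun i j => (hab j i).symm) ht
    simp only [meanDiff_neg, meanDiff_swap a b f, neg_neg] at h1
    simp only [meanDiff_swap a b f] at h2
    rw [min_eq_right h]
    linarith

/-! ### The forest distance -/

theorem forestDist_eq_sum {d k q L : ℕ} (f g : ForestNode k q L → Vec d) :
    ∃ φ : ForestEdge k q L ≃r ForestEdge k q L, forestDist f g = ∑ x, ‖f x - g (φ x)‖ := by
  have : Finite (ForestEdge k q L ≃r ForestEdge k q L) :=
    Finite.of_injective (fun φ => φ.toEquiv) RelIso.toEquiv_injective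
  have : Nonempty (ForestEdge k q L ≃r ForestEdge k q L) := ⟨RelIso.refl _⟩
  obtain ⟨φ, hφ⟩ := exists_eq_ciInf_of_finite
    (f := fun φ : ForestEdge k q L ≃r ForestEdge k q L => ∑ x, ‖f x - g (φ x)‖)
  exact ⟨φ, hφ.symm⟩

theorem forestDist_le_sum {d k q L : ℕ} (f g : ForestNode k q L → Vec d)
    (φ : ForestEdge k q L ≃r ForestEdge k q L) : forestDist f g ≤ ∑ x, ‖f x - g (φ x)‖ :=
  ciInf_le ⟨0, by rintro _ ⟨φ, rfl⟩; positivity⟩ φ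

theorem forestDist_comm_le {d k q L : ℕ} (f g : ForestNode k q L → Vec d) :
    forestDist f g ≤ forestDist g f := by
  obtain ⟨φ, hφ⟩ := forestDist_eq_sum g f
  rw [hφ, ← Equiv.sum_comp φ.symm.toEquiv]
  refine (forestDist_le_sum f g φ.symm).trans_eq (Finset.sum_congr rfl fun x _ => ?_)
  rw [norm_sub_rev]
  simp

theorem forestDist_triangle {d k q L : ℕ} (f g h : ForestNode k q L → Vec d) :
    forestDist f h ≤ forestDist f g + forestDist g h := by
  obtain ⟨φ, hφ⟩ := forestDist_eq_sum f g
  obtain ⟨ψ, hψ⟩ := forestDist_eq_sum g h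
  refine (forestDist_le_sum f h (φ.trans ψ)).trans ?_
  rw [hφ, hψ, ← Equiv.sum_comp φ.toEquiv fun x => ‖g x - h (ψ x)‖, ← Finset.sum_add_distrib]
  exact Finset.sum_le_sum fun x _ => norm_sub_le_norm_sub_add_norm_sub _ _ _

/-- The forest distance does not increase when the padding is changed. -/
theorem forestDist_addr_le {d k q k' q' L : ℕ} {F G : List ℕ → Vec d}
    (hF : ∀ w, F w ≠ 0 → w ≠ [] ∧ IsAddr k q L w ∧ IsAddr k' q' L w)
    (hG : ∀ w, G w ≠ 0 → w ≠ [] ∧ IsAddr k q L w ∧ IsAddr k' q' L w) :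
    forestDist (fun a : ForestNode k' q' L => F (addr a)) (fun a => G (addr a)) ≤
      forestDist (fun a : ForestNode k q L => F (addr a)) (fun a => G (addr a)) := by
  classical
  obtain ⟨φ, hφ⟩ := forestDist_eq_sum (fun a : ForestNode k q L => F (addr a))
    (fun a => G (addr a))
  rw [hφ]
  -- The default `id` matters only at the virtual parent `[]`, which has to be fixed.
  set θ : List ℕ → List ℕ := Function.extend addr (fun a : ForestNode k q L => addr (φ a)) id
    with hθdef
  have hθ : ∀ a : ForestNode k q L, θ (addr a) = addr (φ a) := fun a =>
    (addr_injective k q L).extend_apply _ _ a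
  have hθnil : θ [] = [] := by
    rw [hθdef, Function.extend_apply' _ _ _ (by rintro ⟨a, ha⟩; exact addr_ne_nil a ha)]
    rfl
  have hex : ∀ w, w ≠ [] → IsAddr k q L w → ∃ a : ForestNode k q L, addr a = w :=
    fun w h1 h2 => (exists_addr_eq_iff w).2 ⟨h1, h2⟩
  have hθne : ∀ w, w ≠ [] → IsAddr k q L w → θ w ≠ [] := by
    intro w h1 h2
    obtain ⟨a, rfl⟩ := hex w h1 h2
    rw [hθ]; exact addr_ne_nil _
  have hcons : ∀ j p, IsAddr k q L (j :: p) → ∃ i, θ (j :: p) = i :: θ p := by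
    intro j p h
    obtain ⟨a, ha⟩ := hex _ (List.cons_ne_nil j p) h
    rw [← ha, hθ]
    rcases exists_addr_relIso_cons φ ha with ⟨rfl, i, hi⟩ | ⟨c, rfl, i, hi⟩
    · exact ⟨i, by rw [hi, hθnil]⟩
    · exact ⟨i, by rw [hi, hθ]⟩
  -- `R` consists of the old addresses for which both the address and its image survive in the new
  -- forest. It is closed under parents because `θ` respects parents.
  obtain ⟨s, hs1, hs2, hs3⟩ := exists_portraitMap_extend (branching k' q')
    (R := {w | IsAddr k q L w ∧ IsAddr k' q' L w ∧ IsAddr k' q' L (θ w)}) (θ := θ) hθnil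
    (by
      rintro j p ⟨h1, h2, h3⟩
      obtain ⟨i, hi⟩ := hcons j p h1
      rw [hi] at h3
      exact ⟨h1.2.2, h2.2.2, h3.2.2⟩)
    (by
      rintro j p ⟨h1, h2, h3⟩
      obtain ⟨i, hi⟩ := hcons j p h1
      rw [hi] at h3
      refine ⟨h2.1, i, ?_, hi⟩
      by_cases hp : p = []
      · subst hp
        rw [hθnil] at h3
        exact h3.1
      · have h4 := h3.1
        have h5 := hθne p hp h1.2.2
        rw [branching, if_neg h5] at h4
        rwa [branching, if_neg hp])
    (by
      rintro v ⟨hv, -, -⟩ w ⟨hw, -, -⟩ h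
      by_cases hv0 : v = []
      · by_contra hne
        refine hθne w (fun hw0 => hne (hv0.trans hw0.symm)) hw ?_
        rw [← h, hv0, hθnil]
      by_cases hw0 : w = []
      · exact absurd (by rw [h, hw0, hθnil]) (hθne v hv0 hv)
      obtain ⟨a, rfl⟩ := hex v hv0 hv
      obtain ⟨b, rfl⟩ := hex w hw0 hw
      rw [hθ, hθ] at h
      rw [φ.injective (addr_injective k q L h)])
  obtain ⟨ψ, hψ⟩ := exists_relIso_portraitMap (L := L) hs1 hs2
  refine (forestDist_le_sum _ _ ψ).trans ?_
  have hsum : ∀ (κ r : ℕ) (χ : ForestEdge κ r L ≃r ForestEdge κ r L) (τ : List ℕ → List ℕ),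
      (∀ a, τ (addr a) = addr (χ a)) →
      (∑ a : ForestNode κ r L, ‖F (addr a) - G (addr (χ a))‖ =
        ∑ w ∈ Finset.univ.map ⟨addr, addr_injective κ r L⟩, ‖F w - G (τ w)‖) ∧
      Set.BijOn τ (Finset.univ.map ⟨addr, addr_injective κ r L⟩ : Finset (List ℕ))
        (Finset.univ.map ⟨addr, addr_injective κ r L⟩ : Finset (List ℕ)) := by
    intro κ r χ τ hτ
    refine ⟨by simp [hτ], ?_, ?_, ?_⟩
    · intro w hw
      obtain ⟨a, -, rfl⟩ := Finset.mem_map.1 hw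
      exact Finset.mem_map.2 ⟨χ a, Finset.mem_univ _, (hτ a).symm⟩
    · intro v hv w hw h
      obtain ⟨a, -, rfl⟩ := Finset.mem_map.1 hv
      obtain ⟨b, -, rfl⟩ := Finset.mem_map.1 hw
      have h' : τ (addr a) = τ (addr b) := h
      rw [hτ, hτ] at h'
      rw [χ.injective (addr_injective κ r L h')]
    · intro w hw
      obtain ⟨a, -, rfl⟩ := Finset.mem_map.1 hw
      refine ⟨addr (χ.symm a), Finset.mem_map.2 ⟨χ.symm a, Finset.mem_univ _, rfl⟩, ?_⟩
      rw [hτ, χ.apply_symm_apply]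
      rfl
  have hmem : ∀ (κ r : ℕ) (w : List ℕ),
      w ∈ (Finset.univ.map ⟨addr, addr_injective κ r L⟩ : Finset (List ℕ)) ↔
        w ≠ [] ∧ IsAddr κ r L w := by
    intro κ r w
    rw [← exists_addr_eq_iff]
    simp
  obtain ⟨e1, b1⟩ := hsum k q φ θ hθ
  obtain ⟨e2, b2⟩ := hsum k' q' ψ (portraitMap s) fun a => (hψ a).symm
  rw [e1, e2]
  refine sum_norm_sub_le_of_agree b1 b2 (fun w hw => ?_) (fun w hw => ?_) fun w h1 h2 h3 => ?_
  · obtain ⟨h1, h2, h3⟩ := hF w hw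
    exact ⟨(hmem _ _ _).2 ⟨h1, h2⟩, (hmem _ _ _).2 ⟨h1, h3⟩⟩
  · obtain ⟨h1, h2, h3⟩ := hG w hw
    exact ⟨(hmem _ _ _).2 ⟨h1, h2⟩, (hmem _ _ _).2 ⟨h1, h3⟩⟩
  · exact hs3 w ⟨((hmem _ _ _).1 h1).2, ((hmem _ _ _).1 h2).2, ((hmem _ _ _).1 h3).2⟩

/-! ### The unrolling distance is a pseudometric -/

/-- Feature of the node reached by following the child indices, and `0` if there is none. -/
noncomputable def RTree.featAt {d : ℕ} : RTree d → List ℕ → Vec d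
  | .mk a _ _, [] => a
  | .mk _ n child, i :: p => if h : i < n then (child ⟨i, h⟩).featAt p else 0

theorem RTree.padFeat_eq_featAt {d q : ℕ} (t : RTree d) (p : List (Fin q)) :
    t.padFeat p = t.featAt (p.map Fin.val) := by
  induction p generalizing t with
  | nil => obtain ⟨a, n, c⟩ := t; rfl
  | cons i p ih =>
    obtain ⟨a, n, c⟩ := t
    simp only [List.map_cons, RTree.padFeat, RTree.featAt, ih]

theorem RTree.lt_maxOutDeg_of_featAt_ne_zero {d : ℕ} (t : RTree d) (p : List ℕ)
    (h : t.featAt p ≠ 0) : ∀ j ∈ p, j < t.maxOutDeg := by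
  induction p generalizing t with
  | nil => simp
  | cons i p ih =>
    obtain ⟨a, n, c⟩ := t
    rw [RTree.featAt] at h
    by_cases hi : i < n
    · rw [dif_pos hi] at h
      intro j hj
      rw [RTree.maxOutDeg]
      rcases List.mem_cons.1 hj with rfl | hj
      · exact lt_max_of_lt_left hi
      · exact lt_max_of_lt_right ((ih _ h j hj).trans_le
          (Finset.le_sup (f := fun i => (c i).maxOutDeg) (Finset.mem_univ (⟨i, hi⟩ : Fin n))))
    · exact absurd (dif_neg hi) h

theorem length_le_of_featAt_unr_ne_zero {d : ℕ} (G : FeatGraph d) (L : ℕ) (v : G.V) (p : List ℕ)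
    (h : (unr G L v).featAt p ≠ 0) : p.length ≤ L := by
  induction p generalizing L v with
  | nil => simp
  | cons i p ih =>
    cases L with
    | zero => simp [unr, RTree.featAt] at h
    | succ L =>
      rw [unr, RTree.featAt] at h
      by_cases hi : i < (G.nbrs v).card
      · rw [dif_pos hi] at h
        exact Nat.succ_le_succ (ih L _ h)
      · exact absurd (dif_neg hi) h

section Unrolling

variable {d e : ℕ} (T : FeatGraph d → FeatGraph e)
  (sel : (x : Target d) → Finset (T x.graph).V) (L : ℕ)

/-- The feature at an address of the forest of a target, independently of the padding. -/
noncomputable def addrFeat (x : Target d) (w : List ℕ) : Vec e :=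
  match w.reverse with
  | [] => 0
  | i :: p => if h : i < (sel x).card then (unrollings T sel L x ⟨i, h⟩).featAt p else 0

theorem paddedForest_eq_addrFeat (k q : ℕ) (x : Target d) :
    paddedForest T sel L k q x = fun a => addrFeat T sel L x (addr a) := by
  funext a
  simp [paddedForest, addrFeat, addr, RTree.padFeat_eq_featAt]

/-- Every sufficiently large padding contains all nonzero features; this is the support condition of
`forestDist_addr_le`. -/
theorem isAddr_of_addrFeat_ne_zero {k q : ℕ} {x : Target d} (hk : (sel x).card ≤ k)
    (hq : unrollDeg T sel L x ≤ q) (w : List ℕ) (h : addrFeat T sel L x w ≠ 0) :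
    w ≠ [] ∧ IsAddr k q L w := by
  obtain ⟨r, rfl⟩ : ∃ r : List ℕ, w = r.reverse := ⟨w.reverse, by simp⟩
  rw [addrFeat, List.reverse_reverse] at h
  cases r with
  | nil => exact absurd rfl h
  | cons i p =>
    by_cases hi : i < (sel x).card
    · simp only [hi, dif_pos] at h
      rw [List.reverse_cons, isAddr_append_singleton]
      refine ⟨by simp, hi.trans_le hk, fun j hj => ?_, ?_⟩
      · refine (RTree.lt_maxOutDeg_of_featAt_ne_zero _ p h j (by simpa using hj)).trans_le
          (le_trans ?_ hq)
        exact Finset.le_sup (f := fun i => (unrollings T sel L x i).maxOutDeg)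
          (Finset.mem_univ (⟨i, hi⟩ : Fin (sel x).card))
      · rw [List.length_reverse]
        exact length_le_of_featAt_unr_ne_zero _ L _ p h
    · simp only [hi, dif_neg, not_false_eq_true, ne_eq, not_true_eq_false] at h

/-- The unrolling distance can be computed with any sufficiently large padding. -/
theorem UD_eq_forestDist {k q : ℕ} {x y : Target d} (hkx : (sel x).card ≤ k)
    (hky : (sel y).card ≤ k) (hqx : unrollDeg T sel L x ≤ q) (hqy : unrollDeg T sel L y ≤ q) :
    UD T sel L x y = forestDist (paddedForest T sel L k q x) (paddedForest T sel L k q y) := by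
  simp only [UD, paddedForest_eq_addrFeat]
  have hx := isAddr_of_addrFeat_ne_zero T sel L (le_max_left (sel x).card (sel y).card)
    (le_max_left (unrollDeg T sel L x) (unrollDeg T sel L y))
  have hy := isAddr_of_addrFeat_ne_zero T sel L (le_max_right (sel x).card (sel y).card)
    (le_max_right (unrollDeg T sel L x) (unrollDeg T sel L y))
  have hx' := isAddr_of_addrFeat_ne_zero T sel L hkx hqx
  have hy' := isAddr_of_addrFeat_ne_zero T sel L hky hqy
  exact le_antisymm
    (forestDist_addr_le (fun w h => ⟨(hx w h).1, (hx' w h).2, (hx w h).2⟩)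
      fun w h => ⟨(hy w h).1, (hy' w h).2, (hy w h).2⟩)
    (forestDist_addr_le (fun w h => ⟨(hx w h).1, (hx w h).2, (hx' w h).2⟩)
      fun w h => ⟨(hy w h).1, (hy w h).2, (hy' w h).2⟩)

theorem UD_nonneg (x y : Target d) : 0 ≤ UD T sel L x y :=
  Real.iInf_nonneg fun _ => Finset.sum_nonneg fun _ _ => norm_nonneg _

theorem UD_comm (x y : Target d) : UD T sel L x y = UD T sel L y x := by
  rw [UD_eq_forestDist T sel L (le_max_right (sel y).card (sel x).card) (le_max_left _ _)
    (le_max_right (unrollDeg T sel L y) (unrollDeg T sel L x)) (le_max_left _ _)]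
  exact le_antisymm (forestDist_comm_le _ _) (forestDist_comm_le _ _)

/-- In a padding common to all three targets, optimal automorphisms can be composed. -/
theorem UD_triangle (x y z : Target d) : UD T sel L x z ≤ UD T sel L x y + UD T sel L y z := by
  set k := max (sel x).card (max (sel y).card (sel z).card)
  set q := max (unrollDeg T sel L x) (max (unrollDeg T sel L y) (unrollDeg T sel L z))
  have kx : (sel x).card ≤ k := le_max_left _ _
  have ky : (sel y).card ≤ k := (le_max_left _ _).trans (le_max_right _ _)
  have kz : (sel z).card ≤ k := (le_max_right _ _).trans (le_max_right _ _)
  have qx : unrollDeg T sel L x ≤ q := le_max_left _ _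
  have qy : unrollDeg T sel L y ≤ q := (le_max_left _ _).trans (le_max_right _ _)
  have qz : unrollDeg T sel L z ≤ q := (le_max_right _ _).trans (le_max_right _ _)
  rw [UD_eq_forestDist T sel L kx kz qx qz, UD_eq_forestDist T sel L kx ky qx qy,
    UD_eq_forestDist T sel L ky kz qy qz]
  exact forestDist_triangle _ _ _

end Unrolling

/-! ### Uniform deviations for losses that are nearly constant on cells -/

/-- A linear function on the box `[0, M] ^ ι` is largest at the vertex with value `M` where `D` is
nonnegative and `0` elsewhere. This avoids a factor equal to the number of cells. -/
theorem sum_mul_le_of_sum_le {ι : Type*} [Fintype ι] {v D : ι → ℝ} {M t : ℝ}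
    (hv : ∀ c, 0 ≤ v c ∧ v c ≤ M) (hM : 0 ≤ M) (hD : ∀ S : Finset ι, ∑ c ∈ S, D c ≤ t) :
    ∑ c, v c * D c ≤ M * t := by
  classical
  calc ∑ c, v c * D c ≤ ∑ c, if 0 ≤ D c then M * D c else 0 := by
        refine Finset.sum_le_sum fun c _ => ?_
        split_ifs with h
        · exact mul_le_mul_of_nonneg_right (hv c).2 h
        · exact mul_nonpos_of_nonneg_of_nonpos (hv c).1 (not_le.1 h).le
    _ = M * ∑ c ∈ Finset.univ.filter (fun c => 0 ≤ D c), D c := by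
        rw [← Finset.sum_filter, Finset.mul_sum]
    _ ≤ M * t := mul_le_mul_of_nonneg_left (hD _) hM

theorem meanDiff_sum {α ι : Type*} {m u : ℕ} (a : Fin m → α) (b : Fin u → α)
    (σ : Equiv.Perm α) (S : Finset ι) (w : ι → ℝ) (F : ι → α → ℝ) :
    meanDiff a b (fun i => ∑ c ∈ S, w c * F c i) σ = ∑ c ∈ S, w c * meanDiff a b (F c) σ := by
  simp only [meanDiff, mul_sub, Finset.sum_sub_distrib]
  rw [Finset.sum_comm, Finset.sum_comm (s := Finset.univ) (t := S)]
  simp only [Finset.mul_sum]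
  simp only [mul_left_comm]

theorem abs_meanDiff_le {α : Type*} {m u : ℕ} (a : Fin m → α) (b : Fin u → α)
    (σ : Equiv.Perm α) {f : α → ℝ} {η : ℝ} (hη : 0 ≤ η) (hf : ∀ i, |f i| ≤ η) :
    |meanDiff a b f σ| ≤ 2 * η := by
  have mean : ∀ (n : ℕ) (c : Fin n → α), |(1 / n : ℝ) * ∑ i, f (σ (c i))| ≤ η := by
    intro n c
    rw [abs_mul, abs_of_nonneg (by positivity : (0 : ℝ) ≤ 1 / n)]
    have h1 : |∑ i, f (σ (c i))| ≤ n * η := by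
      refine (Finset.abs_sum_le_sum_abs _ _).trans
        ((Finset.sum_le_sum fun i _ => hf _).trans_eq ?_)
      simp
    refine (mul_le_mul_of_nonneg_left h1 (by positivity)).trans ?_
    rcases Nat.eq_zero_or_pos n with rfl | hn
    · simpa using hη
    · have : (n : ℝ) ≠ 0 := Nat.cast_ne_zero.2 hn.ne'
      rw [one_div, inv_mul_cancel_left₀ this]
  exact (abs_sub _ _).trans ((add_le_add (mean m a) (mean u b)).trans_eq (two_mul η).symm)

/-- If `g` varies by at most `η` on each cell of `κ` and the frequencies of all unions of cells
differ by at most `t`, then the means of `g` differ by at most `2 η + M t`. -/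
theorem abs_meanDiff_le_of_cells {α ι : Type*} [Fintype ι] [DecidableEq ι] {m u : ℕ}
    (a : Fin m → α) (b : Fin u → α) (σ : Equiv.Perm α) (κ : α → ι) {g : α → ℝ} {M η t : ℝ}
    (hM : 0 ≤ M) (hη : 0 ≤ η) (hg : ∀ i, 0 ≤ g i ∧ g i ≤ M)
    (hκ : ∀ i j, κ i = κ j → |g i - g j| ≤ η)
    (ht : ∀ S : Finset ι, |meanDiff a b (fun i => if κ i ∈ S then 1 else 0) σ| ≤ t) :
    |meanDiff a b g σ| ≤ 2 * η + M * t := by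
  classical
  -- The value of `g` at a representative of the cell; on empty cells `0`, to stay within `[0, M]`.
  obtain ⟨v, hv, hgv⟩ : ∃ v : ι → ℝ, (∀ c, 0 ≤ v c ∧ v c ≤ M) ∧ ∀ i, |g i - v (κ i)| ≤ η := by
    refine ⟨fun c => if h : ∃ i, κ i = c then g h.choose else 0, fun c => ?_, fun i => ?_⟩
    · by_cases h : ∃ i, κ i = c
      · simp only [h, dif_pos]
        exact hg _
      · simp only [h, dif_neg, not_false_eq_true]
        exact ⟨le_rfl, hM⟩
    · have h : ∃ j, κ j = κ i := ⟨i, rfl⟩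
      simp only [h, dif_pos]
      exact hκ _ _ h.choose_spec.symm
  set D : ι → ℝ := fun c => meanDiff a b (fun i => if κ i = c then 1 else 0) σ with hDdef
  have hD : ∀ S : Finset ι, |∑ c ∈ S, D c| ≤ t := by
    intro S
    have h := meanDiff_sum a b σ S (fun _ => 1) fun c i => if κ i = c then 1 else 0
    simp only [one_mul, Finset.sum_ite_eq] at h
    rw [← h]
    exact ht S
  have hvD : meanDiff a b (fun i => v (κ i)) σ = ∑ c, v c * D c := by
    rw [← meanDiff_sum]
    simp
  have h1 : |∑ c, v c * D c| ≤ M * t := by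
    refine abs_le'.2 ⟨sum_mul_le_of_sum_le hv hM fun S => (le_abs_self _).trans (hD S), ?_⟩
    rw [← Finset.sum_neg_distrib]
    simp only [← mul_neg]
    refine sum_mul_le_of_sum_le hv hM fun S => ?_
    rw [Finset.sum_neg_distrib]
    exact (neg_le_abs _).trans (hD S)
  have h2 : meanDiff a b g σ =
      meanDiff a b (fun i => g i - v (κ i)) σ + meanDiff a b (fun i => v (κ i)) σ := by
    simp only [meanDiff, Finset.sum_sub_distrib]
    ring
  rw [h2, hvD]
  exact (abs_add_le _ _).trans (add_le_add (abs_meanDiff_le a b σ hη hgv) h1)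

/-- For all but a fraction `δ` of the permutations, the frequencies of all unions of `n` cells in
the two samples are close. -/
theorem card_perm_exists_cells_le {α ι : Type*} [Fintype α] [DecidableEq α] [Fintype ι]
    [DecidableEq ι] {m u : ℕ} (hm : 0 < m) (hu : 0 < u) {a : Fin m → α} {b : Fin u → α}
    (ha : Function.Injective a) (hb : Function.Injective b) (hab : ∀ i j, a i ≠ b j)
    (κ : α → ι) {δ : ℝ} (hδ : 0 < δ) (hδ1 : δ ≤ 1) :
    ((Finset.univ.filter fun σ : Equiv.Perm α => ∃ S : Finset ι,
      (1 / √(m : ℝ) + 1 / √(u : ℝ)) *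
          √(2 * (Fintype.card ι + 1) * Real.log 2 + 2 * Real.log (1 / δ)) ≤
        |meanDiff a b (fun i => if κ i ∈ S then 1 else 0) σ|).card : ℝ) ≤
      δ * (Fintype.card α).factorial := by
  set n := Fintype.card ι
  set r : ℝ := 2 * (n + 1) * Real.log 2 + 2 * Real.log (1 / δ) with hr
  set t : ℝ := (1 / √(m : ℝ) + 1 / √(u : ℝ)) * √r with ht
  have hlog : 0 ≤ Real.log (1 / δ) := Real.log_nonneg ((one_le_div hδ).2 hδ1)
  have hr0 : 0 ≤ r := by
    have := Real.log_nonneg (one_le_two (α := ℝ))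
    positivity
  have ht0 : 0 ≤ t := by positivity
  -- The denominator pays for the `2 ^ n` unions of cells and the two tails. The sum of inverse
  -- roots enters only through its larger term, `1 / √(min m u)`.
  have hexp : Real.exp (-((min m u : ℕ) * t ^ 2 / 2)) ≤ δ / 2 ^ (n + 1) := by
    have h1 : r ≤ (min m u : ℕ) * t ^ 2 := by
      have hpos : 0 < min m u := lt_min hm hu
      have hle : 1 / √((min m u : ℕ) : ℝ) ≤ 1 / √(m : ℝ) + 1 / √(u : ℝ) := by
        rcases min_choice m u with h | h <;> rw [h]
        · exact le_add_of_nonneg_right (by positivity)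
        · exact le_add_of_nonneg_left (by positivity)
      have hsq : 1 / ((min m u : ℕ) : ℝ) ≤ (1 / √(m : ℝ) + 1 / √(u : ℝ)) ^ 2 := by
        have := pow_le_pow_left₀ (by positivity) hle 2
        rwa [div_pow, one_pow, Real.sq_sqrt (Nat.cast_nonneg _)] at this
      rw [ht, mul_pow, Real.sq_sqrt hr0, ← mul_assoc]
      refine le_mul_of_one_le_left hr0 ?_
      have hpos' : (0 : ℝ) < (min m u : ℕ) := Nat.cast_pos.2 hpos
      rwa [div_le_iff₀' hpos'] at hsq
    have h2 : δ / 2 ^ (n + 1) = Real.exp (-(r / 2)) := by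
      rw [← Real.exp_log (by positivity : 0 < δ / 2 ^ (n + 1)),
        Real.log_div hδ.ne' (by positivity), Real.log_pow, hr, one_div, Real.log_inv]
      push_cast
      ring_nf
    rw [h2]
    exact Real.exp_le_exp.2 (by linarith)
  have hsub : (Finset.univ.filter fun σ : Equiv.Perm α => ∃ S : Finset ι,
      t ≤ |meanDiff a b (fun i => if κ i ∈ S then 1 else 0) σ|) ⊆
      (Finset.univ : Finset (Finset ι)).biUnion fun S => Finset.univ.filter fun σ =>
        t ≤ |meanDiff a b (fun i => if κ i ∈ S then 1 else 0) σ| := by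
    intro σ
    simp
  have hcard := (Finset.card_le_card hsub).trans Finset.card_biUnion_le
  calc _ ≤ ∑ S : Finset ι, ((Finset.univ.filter fun σ : Equiv.Perm α =>
          t ≤ |meanDiff a b (fun i => if κ i ∈ S then 1 else 0) σ|).card : ℝ) := by
        exact_mod_cast hcard
    _ ≤ ∑ _S : Finset ι, 2 * ((Fintype.card α).factorial * (δ / 2 ^ (n + 1))) := by
        refine Finset.sum_le_sum fun S _ => ?_
        refine (card_perm_le_abs_meanDiff (fun i j => ?_) hm hu ha hb hab ht0).trans ?_
        · split_ifs <;> norm_num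
        · gcongr
    _ = δ * (Fintype.card α).factorial := by
        rw [Finset.sum_const, Finset.card_univ, Fintype.card_finset, nsmul_eq_mul]
        push_cast
        rw [pow_succ]
        field_simp
        rfl

/-- The law of a uniformly distributed permutation is given by counting. -/
theorem measureReal_uniform_perm {N : ℕ} {Ω : Type*} [MeasurableSpace Ω] (P : Measure Ω)
    [IsProbabilityMeasure P] {π : Ω → Equiv.Perm (Fin N)}
    (hmeas : ∀ σ, MeasurableSet (π ⁻¹' {σ}))
    (hunif : ∀ σ, P.real (π ⁻¹' {σ}) = 1 / (N.factorial : ℝ))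
    (s : Finset (Equiv.Perm (Fin N))) :
    P.real (π ⁻¹' s) = s.card / (N.factorial : ℝ) := by
  have h : π ⁻¹' (s : Set (Equiv.Perm (Fin N))) = ⋃ σ ∈ s, π ⁻¹' {σ} := by
    ext ω; simp
  rw [h, measureReal_biUnion_finset (fun σ _ τ _ hne => ?_) fun σ _ => hmeas σ]
  · simp [hunif, div_eq_mul_inv]
  · exact Disjoint.preimage π (Set.disjoint_singleton.2 hne)

/-- A finite infimum of cardinalities is attained: otherwise every cover would have at least `K + 1`
elements. -/
theorem exists_cover_of_coveringNumber_eq {α : Type*} {X : Set α} {dist : α → α → ℝ} {ε : ℝ}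
    {K : ℕ} (h : coveringNumber X dist ε = K) :
    ∃ C : Set α, C.encard = K ∧ ∀ x ∈ X, ∃ c ∈ C, dist x c ≤ ε := by
  by_contra hne
  push Not at hne
  have h1 : ((K + 1 : ℕ) : ℕ∞) ≤ coveringNumber X dist ε := by
    refine le_iInf fun C => le_iInf fun _ => le_iInf fun hcov => ?_
    have hle : (K : ℕ∞) ≤ C.encard := by
      rw [← h]
      exact iInf_le_of_le C (iInf_le_of_le ‹_› (iInf_le_of_le hcov le_rfl))
    have hneq : (K : ℕ∞) ≠ C.encard := fun he => by
      obtain ⟨x, hx, hx'⟩ := hne C he.symm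
      obtain ⟨c, hc, hxc⟩ := hcov x hx
      exact absurd hxc (not_le.2 (hx' c hc))
    rw [Nat.cast_add, Nat.cast_one]
    exact Order.add_one_le_of_lt (lt_of_le_of_ne hle hneq)
  rw [h] at h1
  exact absurd (Nat.cast_le.1 h1) (by omega)

end GraphLearning

/-- The deviation bound holds simultaneously for all losses that are Lipschitz for the unrolling
distance, with `C = 2 * Lℓ`: targets near the same centre of the cover have nearly equal losses, and
the frequencies of the cells of the cover in the training and the test part concentrate. -/
theorem mainTheorem4 :
    -- the constant `C` depends on `L`, the `L_φₜ` and `L_ℓ` only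
    ∃ C : (L : ℕ) → (Fin L → ℝ≥0) → ℝ≥0 → ℝ,
    ∀ (d L p : ℕ) (dim : Fin (L + 1) → ℕ)
      (T : GraphLearning.FeatGraph d → GraphLearning.FeatGraph (dim 0))
      (sel : (x : GraphLearning.Target d) → Finset (T x.graph).V)
      -- the input space: node targets or link targets
      (X : Set (GraphLearning.Target d))
      (_ : X ⊆ GraphLearning.nodeTargets d ∨ X ⊆ GraphLearning.linkTargets d)
      -- the hypothesis class
      (Lφ : Fin L → ℝ≥0) (B : ℝ)
      (H : Set (GraphLearning.GenMPNN dim T sel p))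
      (_ : ∀ h ∈ H, h.Bounded Lφ B ∧ h.SubSum X)
      -- the data, with `m` training and `u` test positions
      (m u : ℕ) (_ : 0 < m) (_ : 0 < u)
      (x : Fin (m + u) → GraphLearning.Target d) (y : Fin (m + u) → Bool)
      (_ : ∀ i, x i ∈ X)
      -- the loss
      (loss : H → GraphLearning.Target d × Bool → ℝ) (M : ℝ) (Lℓ : ℝ≥0)
      (_ : ∀ h i, 0 ≤ loss h (x i, y i) ∧ loss h (x i, y i) ≤ M)
      (_ : ∀ h i j, GraphLearning.dInfty T sel L (x i, y i) (x j, y j) ≠ ⊤ →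
        |loss h (x i, y i) - loss h (x j, y j)| ≤
          Lℓ * (GraphLearning.dInfty T sel L (x i, y i) (x j, y j)).toReal)
      -- the stable transductive learning algorithm
      (A : Equiv.Perm (Fin (m + u)) → H) (β : ℝ) (_ : 0 < β)
      (_ : GraphLearning.TransductiveStable (fun π => (A π).1) x β)
      -- the uniformly distributed random permutation
      (Ω : Type*) (_ : MeasurableSpace Ω) (P : Measure Ω) (_ : IsProbabilityMeasure P)
      (π : Ω → Equiv.Perm (Fin (m + u)))
      (_ : ∀ σ, MeasurableSet (π ⁻¹' {σ}))
      (_ : ∀ σ, P.real (π ⁻¹' {σ}) = 1 / (Nat.factorial (m + u) : ℝ))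
      (ε δ : ℝ) (_ : 0 < ε) (_ : 0 < δ)
      (K : ℕ) (_ : GraphLearning.coveringNumber X (GraphLearning.UD T sel L) ε = K),
      1 - δ ≤ P.real {ω |
        |GraphLearning.riskTrain (fun i => loss (A (π ω)) (x i, y i)) (π ω)
            - GraphLearning.riskTest (fun i => loss (A (π ω)) (x i, y i)) (π ω)| ≤
          2 * C L Lφ Lℓ * ε
            + M * K * (1 / √(m : ℝ) + 1 / √(u : ℝ))
                * √(2 * (2 * K + 1) * Real.log 2 + 2 * Real.log (1 / δ))
            + Lℓ * β} := by
  classical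
  refine ⟨fun _ _ Lℓ => 2 * Lℓ, ?_⟩
  intro d L p dim T sel X _ Lφ B H _ m u hm hu x y hxX loss M Lℓ hbound hlip A β hβ _ Ω _ P _ π
    hmeas hunif ε δ hε hδ K hK
  rcases lt_or_ge 1 δ with hδ1 | hδ1
  · exact (sub_nonpos.2 hδ1.le).trans measureReal_nonneg
  obtain ⟨C, hCK, hC⟩ := GraphLearning.exists_cover_of_coveringNumber_eq hK
  have hCfin : C.Finite := Set.finite_of_encard_eq_coe hCK
  have : Fintype C := hCfin.fintype
  have hcard : Fintype.card C = K := by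
    have h := Set.encard_eq_coe_toFinset_card C
    rw [hCK, Set.toFinset_card] at h
    exact_mod_cast h.symm
  choose c hcC hc using fun i => hC (x i) (hxX i)
  -- The label belongs to the cell because `dInfty` is infinite between different labels. The
  -- resulting `2 * K` cells account for the `2 * K + 1` under the root.
  set κ : Fin (m + u) → C × Bool := fun i => (⟨c i, hcC i⟩, y i) with hκ
  have hK1 : (1 : ℝ) ≤ K := by
    rw [← hcard]
    exact_mod_cast Fintype.card_pos_iff.2 ⟨(⟨c ⟨0, by omega⟩, hcC _⟩ : C)⟩
  have hM : 0 ≤ M := (hbound (A 1) ⟨0, by omega⟩).1.trans (hbound (A 1) ⟨0, by omega⟩).2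
  have hcell : ∀ (h : H) (i j : Fin (m + u)), κ i = κ j →
      |loss h (x i, y i) - loss h (x j, y j)| ≤ Lℓ * (2 * ε) := by
    intro h i j hij
    have hij1 : c i = c j := congrArg (fun z => (z.1 : GraphLearning.Target d)) hij
    have hij2 : y i = y j := congrArg Prod.snd hij
    have hUD : GraphLearning.UD T sel L (x i) (x j) ≤ 2 * ε := by
      have h1 := hc i
      have h2 := hc j
      rw [GraphLearning.UD_comm, ← hij1] at h2
      have h3 := GraphLearning.UD_triangle T sel L (x i) (c i) (x j)
      linarith
    have hd : GraphLearning.dInfty T sel L (x i, y i) (x j, y j) =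
        ENNReal.ofReal (GraphLearning.UD T sel L (x i) (x j)) := by
      simp [GraphLearning.dInfty, GraphLearning.labelDist, hij2]
    have h1 := hlip h i j (by rw [hd]; exact ENNReal.ofReal_ne_top)
    rw [hd, ENNReal.toReal_ofReal (GraphLearning.UD_nonneg T sel L _ _)] at h1
    exact h1.trans (mul_le_mul_of_nonneg_left hUD Lℓ.2)
  set t : ℝ := (1 / √(m : ℝ) + 1 / √(u : ℝ)) *
    √(2 * (2 * K + 1) * Real.log 2 + 2 * Real.log (1 / δ)) with ht
  have ht0 : 0 ≤ t := by positivity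
  -- This event involves only the cells and not the loss, so on its complement the hypothesis may
  -- depend on `σ`.
  set bad : Finset (Equiv.Perm (Fin (m + u))) := Finset.univ.filter fun σ =>
    ∃ S : Finset (C × Bool), t ≤ |GraphLearning.meanDiff (Fin.castAdd u) (Fin.natAdd m)
      (fun i => if κ i ∈ S then 1 else 0) σ| with hbad
  have hbadcard : (bad.card : ℝ) ≤ δ * (m + u).factorial := by
    have h := GraphLearning.card_perm_exists_cells_le hm hu (Fin.castAdd_injective m u)
      (Fin.natAdd_injective u m)
      (fun i j h => by
        have := congrArg Fin.val h
        simp only [Fin.val_castAdd, Fin.val_natAdd] at this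
        omega) κ hδ hδ1
    have hcells : (Fintype.card (C × Bool) : ℝ) = 2 * K := by
      rw [Fintype.card_prod, hcard, Fintype.card_bool]
      push_cast
      ring
    rw [hcells, Fintype.card_fin] at h
    exact h
  have hgood : ((Finset.univ \ bad : Finset _) : Set (Equiv.Perm (Fin (m + u)))) ⊆ {σ |
      |GraphLearning.riskTrain (fun i => loss (A σ) (x i, y i)) σ
          - GraphLearning.riskTest (fun i => loss (A σ) (x i, y i)) σ| ≤
        2 * (2 * Lℓ) * ε
          + M * K * (1 / √(m : ℝ) + 1 / √(u : ℝ))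
              * √(2 * (2 * K + 1) * Real.log 2 + 2 * Real.log (1 / δ))
          + Lℓ * β} := by
    intro σ hσ
    have hσ' : ∀ S : Finset (C × Bool), |GraphLearning.meanDiff (Fin.castAdd u) (Fin.natAdd m)
        (fun i => if κ i ∈ S then 1 else 0) σ| ≤ t := by
      intro S
      by_contra hS
      simp only [Finset.coe_sdiff, Set.mem_sdiff, Finset.mem_coe] at hσ
      exact hσ.2 (Finset.mem_filter.2 ⟨Finset.mem_univ _, S, (not_le.1 hS).le⟩)
    have h := GraphLearning.abs_meanDiff_le_of_cells _ _ σ κ hM (by positivity)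
      (fun i => hbound (A σ) i) (fun i j hij => hcell (A σ) i j hij) hσ'
    -- The bound `h` already gives `2 * (Lℓ * (2 * ε)) + M * t`, and its first term is `2 * C * ε`
    -- for `C = 2 * Lℓ`. The factor `K ≥ 1` and the summand `Lℓ * β ≥ 0` only enlarge the right-hand
    -- side.
    have h1 : M * t ≤ M * K * t := by
      rw [mul_right_comm]
      exact le_mul_of_one_le_right (mul_nonneg hM ht0) hK1
    have h2 : 0 ≤ Lℓ * β := mul_nonneg Lℓ.2 hβ.le
    refine h.trans ?_
    rw [mul_assoc (M * K), ← ht]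
    linarith
  have hcount : 1 - δ ≤ P.real (π ⁻¹' ((Finset.univ \ bad : Finset _) :
      Set (Equiv.Perm (Fin (m + u))))) := by
    have hN : (0 : ℝ) < (m + u).factorial := by positivity
    rw [GraphLearning.measureReal_uniform_perm P hmeas hunif, le_div_iff₀ hN,
      ← Finset.compl_eq_univ_sdiff, Finset.card_compl, Fintype.card_perm, Fintype.card_fin,
      Nat.cast_sub (by simpa [Fintype.card_perm] using Finset.card_le_univ bad)]
    linarith
  exact hcount.trans (measureReal_mono (Set.preimage_mono hgood))
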